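/- \textbf{Setting.} Let $\mathbb{G}=(\mathbb{V},\mathbb{E})$ be a finite undirected graph without loops whose vertices are agents, $\mathbb{V}=\mathcal{L}\sqcup\mathcal{M}$ with $\mathcal{L}$ the legitimate and $\mathcal{M}$ the malicious agents, and let $\mathcal{N}_i$ be the set of neighbors of $i$. Assume: (a) the subgraph induced by $\mathcal{L}$ is connected (in particular $\mathcal{L}\neq\emptyset$); (b) for $i\in\mathcal{L}$, $j\in\mathcal{N}_i$, $t\ge 0$ the trust observations $\alpha_{ij}(t)$ are $[0,1]$-valued random variables on a probability space, mutually independent over all such $(i,j,t)$, identically distributed in $t$ for each fixed $(i,j)$, and there are constants $E_{\mathcal L}>0>E_{\mathcal M}$ with $\mathbf{E}[\alpha_{ij}(t)]-\tfrac12=E_{\mathcal L}$ if $j\in\mathcal{L}$ and $\mathbf{E}[\alpha_{ij}(t)]-\tfrac12=E_{\mathcal M}$ if $j\in\mathcal{M}$; (c) $\mathcal{X}\subset\mathbb{R}^d$ is compact and convex; (d) for $i\in\mathcal{L}$, $f_i:\mathbb{R}^d\to\mathbb{R}$ is differentiable and $\mu$-strongly convex with $\mu>0$, and $\|\nabla f_i(x)-\nabla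 f_i(y)\|\le L\|x-y\|$ for all $x,y\in\mathbb{R}^d$; (e) $\gamma(0)\ge\gamma(1)\ge\dots\ge0$, $\sum_{t\ge0}\gamma(t)=\infty$, $\sum_{t\ge0}\gamma(t)^2<\infty$; put $\gamma(k)=0$ for $k<0$. \textbf{Algorithm.} Fix an integer $T_0\ge0$. For $i\in\mathcal{L}$, $j\in\mathcal{N}_i$ let $\beta_{ij}(t)=\sum_{k=0}^{t-1}(\alpha_{ij}(k)-\tfrac12)$, $\mathcal{N}_i(t)=\{j\in\mathcal{N}_i:\beta_{ij}(t)\ge0\}$ and $d_i(t)=|\mathcal{N}_i(t)|+1$. At each time $t$ every agent $j$ sends to each neighbor $i\in\mathcal{L}$ a value $x_{ji}(t)$ and a number $d_{ji}(t)$. If $j\in\mathcal{L}$, then $x_{ji}(t)=x_j(t)$ and $d_{ji}(t)=d_j(t)$. If $j\in\mathcal{M}$, then $x_{ji}(t)$ is an arbitrary $\mathcal{X}$-valued random variable and $d_{ji}(t)$ an arbitrary real random variable; both may depend on the receiver $i$ and, in any way, on all other random quantities. For $i\in\mathcal{L}$ put \[w_{ij}(t)=\frac{\mathbf{1}_{\{t\ge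 T_0\}}\mathbf{1}_{\{j\in\mathcal{N}_i(t)\}}}{2\max\{d_i(t),d_{ji}(t)\}}\quad(j\in\mathcal{N}_i),\qquad w_{ii}(t)=1-\sum_{m\in\mathcal{N}_i}w_{im}(t).\] Starting from arbitrary $\mathcal{X}$-valued random variables $x_i(0)$, $i\in\mathcal{L}$, the legitimate agents iterate \[c_i(t)=w_{ii}(t)x_i(t)+\sum_{j\in\mathcal{N}_i(t)}w_{ij}(t)x_{ji}(t),\qquad x_i(t+1)=\Pi_{\mathcal{X}}\bigl(c_i(t)-\gamma(t-T_0)\nabla f_i(c_i(t))\bigr),\] where $\Pi_{\mathcal{X}}$ is the Euclidean projection onto $\mathcal{X}$. \textbf{Theorem (convergence in mean to the optimal point).} The function $f_{\mathcal{L}}=\frac{1}{|\mathcal{L}|}\sum_{i\in\mathcal{L}}f_i$ has a unique minimizer $x_{\mathcal{L}}^\star$ over $\mathcal{X}$, and for every integer $T_0\ge0$, every $i\in\mathcal{L}$ and every real $r\ge1$, the expectations $\mathbf{E}\bigl[\|x_i(t)-x_{\mathcal{L}}^\star\|^r\bigr]$, $t\ge 0$, are finite and \[\lim_{t\to\infty}\mathbf{E}\bigl[\|x_i(t)-x_{\mathcal{L}}^\star\|^r\bigr]=0.\]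 -/

import Mathlib

open MeasureTheory ProbabilityTheory Filter Topology

noncomputable section

/-- `ℝ^d` with the Euclidean norm. -/
abbrev RSpace (d : ℕ) : Type := EuclideanSpace ℝ (Fin d)

/-- The projection `Π_X(y) = argmin_{z ∈ X} ‖z - y‖`. -/
def proj {d : ℕ} (X : Set (RSpace d)) (y : RSpace d) : RSpace d :=
  Classical.epsilon fun z => z ∈ X ∧ IsMinOn (fun z' => ‖z' - y‖) X z

/-- The data of a multi-agent system, on the sample space `Ω`. No property is assumed here.
The agents are the elements of `V`; the malicious agents are those outside `L`. -/
structure MultiAgentSystem (V Ω : Type*) (d : ℕ) where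
  /-- the (undirected) communication graph -/
  G : SimpleGraph V
  /-- the set of legitimate agents -/
  L : Finset V
  /-- the constraint set -/
  X : Set (RSpace d)
  /-- the local objective functions -/
  f : V → RSpace d → ℝ
  /-- the stepsizes `γ(0), γ(1), …` -/
  γ : ℕ → ℝ
  /-- `α i j t` is agent `i`'s observation at time `t` of the trustworthiness of agent `j` -/
  α : V → V → ℕ → Ω → ℝ
  /-- the initial values -/
  x0 : V → Ω → RSpace d
  /-- `advValue j i t` is the value that a malicious agent `j` sends to agent `i` at time `t` -/
  advValue : V → V → ℕ → Ω → RSpace d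
  /-- `advDegree j i t` is what a malicious agent `j` sends to agent `i` at time `t`
  in place of the number of its trusted neighbors plus one -/
  advDegree : V → V → ℕ → Ω → ℝ

namespace MultiAgentSystem

variable {V Ω : Type*} {d : ℕ}

/-- `β_ij(t) = ∑_{k < t} (α_ij(k) - 1/2)`. -/
def β (S : MultiAgentSystem V Ω d) (i j : V) (t : ℕ) (ω : Ω) : ℝ :=
  ∑ k ∈ Finset.range t, (S.α i j k ω - 1 / 2)

/-- The average objective `f_L` of the legitimate agents. -/
def fL (S : MultiAgentSystem V Ω d) (x : RSpace d) : ℝ :=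
  (1 / (S.L.card : ℝ)) * ∑ i ∈ S.L, S.f i x

/-- `x` is a minimizer of `f_L` over `X`. -/
def IsOptimal (S : MultiAgentSystem V Ω d) (x : RSpace d) : Prop :=
  x ∈ S.X ∧ IsMinOn S.fL S.X x

/-- The stepsize `γ(t - T₀)`, with `γ(k) = 0` for `k < 0`. -/
def delayedStep (S : MultiAgentSystem V Ω d) (T₀ t : ℕ) : ℝ :=
  if T₀ ≤ t then S.γ (t - T₀) else 0

variable [Fintype V]

open Classical in
/-- The neighborhood `N_i`. -/
def nbrs (S : MultiAgentSystem V Ω d) (i : V) : Finset V :=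
  Finset.univ.filter fun j => S.G.Adj i j

open Classical in
/-- The trusted neighborhood `N_i(t) = {j ∈ N_i : β_ij(t) ≥ 0}`. -/
def trusted (S : MultiAgentSystem V Ω d) (i : V) (t : ℕ) (ω : Ω) : Finset V :=
  (S.nbrs i).filter fun j => 0 ≤ S.β i j t ω

/-- `d_i(t) = |N_i(t)| + 1`. -/
def deg (S : MultiAgentSystem V Ω d) (i : V) (t : ℕ) (ω : Ω) : ℝ :=
  ((S.trusted i t ω).card : ℝ) + 1

open Classical in
/-- The value `d_j(t)` as agent `i` receives it from agent `j`. -/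
def receivedDeg (S : MultiAgentSystem V Ω d) (i j : V) (t : ℕ) (ω : Ω) : ℝ :=
  if j ∈ S.L then S.deg j t ω else S.advDegree j i t ω

open Classical in
/-- The weight `w_ij(t)` that agent `i` gives to its neighbor `j`. -/
def weight (S : MultiAgentSystem V Ω d) (T₀ : ℕ) (i j : V) (t : ℕ) (ω : Ω) : ℝ :=
  if T₀ ≤ t ∧ j ∈ S.trusted i t ω then
    1 / (2 * max (S.deg i t ω) (S.receivedDeg i j t ω))
  else 0

/-- The weight `w_ii(t) = 1 - ∑_{m ∈ N_i} w_im(t)`. -/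
def selfWeight (S : MultiAgentSystem V Ω d) (T₀ : ℕ) (i : V) (t : ℕ) (ω : Ω) : ℝ :=
  1 - ∑ m ∈ S.nbrs i, S.weight T₀ i m t ω

open Classical in
/-- The combination `c_i(t)`, when `x j ω` is the value of the legitimate agent `j` at time `t`. -/
def mix (S : MultiAgentSystem V Ω d) (T₀ t : ℕ) (x : V → Ω → RSpace d) (i : V) (ω : Ω) :
    RSpace d :=
  S.selfWeight T₀ i t ω • x i ω
    + ∑ j ∈ (S.trusted i t ω).filter (fun j => j ∈ S.L), S.weight T₀ i j t ω • x j ω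
    + ∑ j ∈ (S.trusted i t ω).filter (fun j => j ∉ S.L),
        S.weight T₀ i j t ω • S.advValue j i t ω

/-- The values `x_i(t)` of the agents `i ∈ L`. (Values at `i ∉ L` are never used: all that
the agents outside `L` contribute to the dynamic is given by `advValue` and `advDegree`.) -/
def x (S : MultiAgentSystem V Ω d) (T₀ : ℕ) : ℕ → V → Ω → RSpace d
  | 0 => S.x0
  | t + 1 => fun i ω =>
      proj S.X (S.mix T₀ t (S.x T₀ t) i ω
        - S.delayedStep T₀ t • gradient (S.f i) (S.mix T₀ t (S.x T₀ t) i ω))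

/-- The standing assumptions, with trust biases `EL > 0 > EM`, strong convexity constant `μ` and
gradient Lipschitz constant `Lip`. -/
structure Assumptions [MeasurableSpace Ω] (S : MultiAgentSystem V Ω d) (P : Measure Ω)
    (EL EM μ Lip : ℝ) : Prop where
  /-- the subgraph induced by the legitimate agents is connected -/
  connected : (S.G.induce (S.L : Set V)).Connected
  /-- the trust observations are random variables in `[0, 1]` -/
  α_measurable : ∀ i ∈ S.L, ∀ j, S.G.Adj i j → ∀ t, Measurable (S.α i j t)
  α_mem : ∀ i ∈ S.L, ∀ j, S.G.Adj i j → ∀ t ω, S.α i j t ω ∈ Set.Icc (0 : ℝ) 1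
  EL_pos : 0 < EL
  EM_neg : EM < 0
  mean_legitimate : ∀ i ∈ S.L, ∀ j ∈ S.L, S.G.Adj i j → ∀ t, (∫ ω, S.α i j t ω ∂P) - 1 / 2 = EL
  mean_malicious : ∀ i ∈ S.L, ∀ j ∉ S.L, S.G.Adj i j → ∀ t, (∫ ω, S.α i j t ω ∂P) - 1 / 2 = EM
  /-- all the observations (over all times and all pairs) are mutually independent -/
  indep : iIndepFun
    (fun p : {e : V × V // e.1 ∈ S.L ∧ S.G.Adj e.1 e.2} × ℕ => S.α p.1.1.1 p.1.1.2 p.2) P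
  identDistrib : ∀ i ∈ S.L, ∀ j, S.G.Adj i j → ∀ s t, IdentDistrib (S.α i j s) (S.α i j t) P P
  X_compact : IsCompact S.X
  X_convex : Convex ℝ S.X
  μ_pos : 0 < μ
  strongConvex : ∀ i ∈ S.L, StrongConvexOn Set.univ μ (S.f i)
  differentiable : ∀ i ∈ S.L, Differentiable ℝ (S.f i)
  gradient_lipschitz : ∀ i ∈ S.L, ∀ x y,
    ‖gradient (S.f i) x - gradient (S.f i) y‖ ≤ Lip * ‖x - y‖
  γ_nonneg : ∀ t, 0 ≤ S.γ t
  γ_antitone : Antitone S.γ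
  γ_sum : Tendsto (fun n => ∑ t ∈ Finset.range n, S.γ t) atTop atTop
  γ_sq_sum : Summable fun t => S.γ t ^ 2
  /-- the legitimate agents start in `X` -/
  x0_measurable : ∀ i ∈ S.L, Measurable (S.x0 i)
  x0_mem : ∀ i ∈ S.L, ∀ ω, S.x0 i ω ∈ S.X
  /-- the malicious agents send arbitrary random elements of `X` -/
  advValue_measurable : ∀ i ∈ S.L, ∀ j ∉ S.L, S.G.Adj i j → ∀ t, Measurable (S.advValue j i t)
  advValue_mem : ∀ i ∈ S.L, ∀ j ∉ S.L, S.G.Adj i j → ∀ t ω, S.advValue j i t ω ∈ S.X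
  /-- the malicious agents report arbitrary random numbers as their degrees -/
  advDegree_measurable : ∀ i ∈ S.L, ∀ j ∉ S.L, S.G.Adj i j → ∀ t, Measurable (S.advDegree j i t)

end MultiAgentSystem

end

/-! Convergence is proved path by path and then passed to expectations. By the strong law of large
numbers `β i j t / t` tends to the trust bias, whose sign separates legitimate from malicious
neighbors. Hence almost surely, after a random finite time, exactly the legitimate neighbors are
trusted (`ae_eventually_trusted_eq`). From then on the adversary has no influence except through the
current state, which lies in the compact set `X`, and the weights are fixed, symmetric and supported
on a connected graph.

It remains to treat a deterministic projected gradient method from an arbitrary state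
(`tendsto_of_projected_averaging`). Averaging contracts the disagreement by a fixed factor and the
gradient step perturbs it by `O(γ)`, so consensus follows from `γ → 0`. Strong convexity then gives
`V (t + 1) ≤ (1 - γ μ) V t + γ o(1)` for the sum `V` of squared distances to the optimum, and `∑ γ =
∞` forces `V → 0`. Both recursions are instances of `tendsto_zero_of_le_one_sub_mul_add`.

All iterates stay in `X`, so dominated convergence with a constant bound yields every moment; no
rate for the random time is needed. -/

/-- A nonnegative sequence with `u (t + 1) ≤ (1 - a t) * u t + a t * ε t` tends to `0` when
`∑ a = ∞` and `ε → 0`. -/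
theorem tendsto_zero_of_le_one_sub_mul_add {u a ε : ℕ → ℝ} (hu : ∀ t, 0 ≤ u t)
    (ha : ∀ᶠ t in atTop, 0 ≤ a t ∧ a t ≤ 1)
    (hsum : Tendsto (fun n => ∑ t ∈ Finset.range n, a t) atTop atTop)
    (hε : Tendsto ε atTop (𝓝 0))
    (hrec : ∀ᶠ t in atTop, u (t + 1) ≤ (1 - a t) * u t + a t * ε t) :
    Tendsto u atTop (𝓝 0) := by
  refine Metric.tendsto_atTop.2 fun δ hδ => ?_
  have hδ2 : 0 < δ / 2 := half_pos hδ
  have hε' : ∀ᶠ t in atTop, ε t ≤ δ / 2 := (hε.eventually (gt_mem_nhds hδ2)).mono fun _ h => h.le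
  obtain ⟨T, hT⟩ := eventually_atTop.1 (ha.and (hrec.and hε'))
  set S : ℕ → ℝ := fun n => ∑ t ∈ Finset.range n, a t with hS
  -- Chosen so that the bound in `key` holds at `t = T`; the absolute value keeps `C` nonnegative.
  set C : ℝ := |u T - δ / 2| * Real.exp (S T) with hC
  have hC0 : 0 ≤ C := by positivity
  have key : ∀ t, T ≤ t → u t - δ / 2 ≤ C * Real.exp (-S t) := by
    intro t ht
    induction t, ht using Nat.le_induction with
    | base =>
      rw [hC, mul_assoc, ← Real.exp_add]
      simpa using le_abs_self (u T - δ / 2)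
    | succ t ht ih =>
      obtain ⟨⟨h0, h1⟩, h2, h3⟩ := hT t ht
      have hSs : S (t + 1) = S t + a t := Finset.sum_range_succ _ _
      calc u (t + 1) - δ / 2 ≤ (1 - a t) * (u t - δ / 2) := by nlinarith
        _ ≤ (1 - a t) * (C * Real.exp (-S t)) := mul_le_mul_of_nonneg_left ih (by linarith)
        _ ≤ Real.exp (-a t) * (C * Real.exp (-S t)) :=
          mul_le_mul_of_nonneg_right (Real.one_sub_le_exp_neg _) (by positivity)
        _ = C * Real.exp (-S (t + 1)) := by rw [hSs, neg_add, Real.exp_add]; ring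
  have hlim : Tendsto (fun t => C * Real.exp (-S t)) atTop (𝓝 0) := by
    simpa using (Real.tendsto_exp_neg_atTop_nhds_zero.comp hsum).const_mul C
  obtain ⟨T', hT'⟩ := eventually_atTop.1 (hlim.eventually (gt_mem_nhds hδ2))
  refine ⟨max T T', fun t ht => ?_⟩
  have h1 := key t ((le_max_left _ _).trans ht)
  have h2 := hT' t ((le_max_right _ _).trans ht)
  rw [Real.dist_eq, sub_zero, abs_of_nonneg (hu t)]
  linarith

/-- The first-order characterization of strong convexity. -/
theorem StrongConvexOn.add_inner_gradient_le {E : Type*} [NormedAddCommGroup E]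
    [InnerProductSpace ℝ E] [CompleteSpace E] {f : E → ℝ} {μ : ℝ}
    (hf : StrongConvexOn Set.univ μ f) {x : E} (hd : DifferentiableAt ℝ f x) (y : E) :
    f x + inner ℝ (gradient f x) (y - x) + μ / 2 * ‖y - x‖ ^ 2 ≤ f y := by
  have h1 := (hd.hasGradientAt.hasFDerivAt.hasLineDerivAt (y - x)).tendsto_slope_zero_right
  -- Strong convexity on the segment from `x` to `y`, divided by `t`, bounds the difference quotient
  -- by this function; then `t → 0` from the right.
  have h2 : Tendsto (fun t : ℝ => f y - f x - (1 - t) * (μ / 2 * ‖y - x‖ ^ 2)) (𝓝[>] 0)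
      (𝓝 (f y - f x - (1 - 0) * (μ / 2 * ‖y - x‖ ^ 2))) := by
    refine Tendsto.mono_left ?_ nhdsWithin_le_nhds
    exact (by fun_prop : Continuous fun t : ℝ =>
      f y - f x - (1 - t) * (μ / 2 * ‖y - x‖ ^ 2)).tendsto 0
  have h3 := le_of_tendsto_of_tendsto h1 h2 ?_
  · rw [InnerProductSpace.toDual_apply_apply] at h3
    linarith
  · filter_upwards [Ioo_mem_nhdsGT (zero_lt_one' ℝ)] with t ht
    have h4 := hf.2
    replace h4 := @h4 x (Set.mem_univ x) y (Set.mem_univ y) (1 - t) t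
      (by linarith [ht.2]) ht.1.le (by ring)
    have h5 : (1 - t) • x + t • y = x + t • (y - x) := by module
    rw [h5, norm_sub_rev] at h4
    simp only [smul_eq_mul] at h4 ⊢
    rw [inv_mul_le_iff₀ ht.1]
    nlinarith

/-! ### Euclidean projection onto a compact convex set -/

section Projection

variable {d : ℕ} {X : Set (RSpace d)}

theorem proj_spec (hc : IsCompact X) (hne : X.Nonempty) (y : RSpace d) :
    proj X y ∈ X ∧ IsMinOn (fun z' => ‖z' - y‖) X (proj X y) :=
  Classical.epsilon_spec (p := fun z => z ∈ X ∧ IsMinOn (fun z' => ‖z' - y‖) X z)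
    (hc.exists_isMinOn hne (by fun_prop))

theorem proj_mem (hc : IsCompact X) (hne : X.Nonempty) (y : RSpace d) : proj X y ∈ X :=
  (proj_spec hc hne y).1

theorem inner_sub_proj_nonpos (hc : IsCompact X) (hX : Convex ℝ X) (y : RSpace d) {z : RSpace d}
    (hz : z ∈ X) : inner ℝ (y - proj X y) (z - proj X y) ≤ 0 := by
  obtain ⟨hm, hmin⟩ := proj_spec hc ⟨z, hz⟩ y
  refine (norm_eq_iInf_iff_real_inner_le_zero hX hm).1 ?_ z hz
  have : Nonempty X := ⟨⟨z, hz⟩⟩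
  refine le_antisymm (le_ciInf fun w => ?_)
    (ciInf_le (f := fun w : X => ‖y - w‖) ⟨0, Set.forall_mem_range.2 fun _ => norm_nonneg _⟩
      ⟨_, hm⟩)
  simpa only [norm_sub_rev y] using isMinOn_iff.1 hmin w w.2

theorem proj_eq_self (hc : IsCompact X) {z : RSpace d} (hz : z ∈ X) : proj X z = z := by
  have h := isMinOn_iff.1 (proj_spec hc ⟨z, hz⟩ z).2 z hz
  simp only [sub_self, norm_zero] at h
  exact sub_eq_zero.1 (norm_le_zero_iff.1 h)

theorem norm_proj_sub_proj_le (hc : IsCompact X) (hX : Convex ℝ X) (hne : X.Nonempty)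
    (y z : RSpace d) : ‖proj X y - proj X z‖ ≤ ‖y - z‖ := by
  have h1 := inner_sub_proj_nonpos hc hX y (proj_mem hc hne z)
  have h2 := inner_sub_proj_nonpos hc hX z (proj_mem hc hne y)
  -- Firm nonexpansiveness, from adding the two variational inequalities; Cauchy–Schwarz finishes.
  have h3 : ‖proj X y - proj X z‖ ^ 2 ≤ inner ℝ (y - z) (proj X y - proj X z) := by
    have : inner ℝ (y - z) (proj X y - proj X z) - ‖proj X y - proj X z‖ ^ 2
        = - inner ℝ (y - proj X y) (proj X z - proj X y)
          - inner ℝ (z - proj X z) (proj X y - proj X z) := by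
      rw [← real_inner_self_eq_norm_sq]
      simp only [inner_sub_left, inner_sub_right]
      ring
    linarith
  have h4 := h3.trans (real_inner_le_norm _ _)
  by_contra! h
  nlinarith [norm_nonneg (y - z)]

theorem norm_proj_sub_le (hc : IsCompact X) (hX : Convex ℝ X) (y : RSpace d) {z : RSpace d}
    (hz : z ∈ X) : ‖proj X y - z‖ ≤ ‖y - z‖ := by
  simpa only [proj_eq_self hc hz] using norm_proj_sub_proj_le hc hX ⟨z, hz⟩ y z

theorem continuous_proj (hc : IsCompact X) (hX : Convex ℝ X) (hne : X.Nonempty) :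
    Continuous (proj X) := by
  refine (LipschitzWith.of_dist_le_mul (K := 1) fun y z => ?_).continuous
  simpa [dist_eq_norm] using norm_proj_sub_proj_le hc hX hne y z

end Projection

/-! ### Symmetric averaging and consensus -/

section Averaging

variable {ι E : Type*} [Fintype ι] [NormedAddCommGroup E]

/-- Averaging of the values `x` with weights `a`. -/
noncomputable def averaged [NormedSpace ℝ E] (a : ι → ι → ℝ) (x : ι → E) (i : ι) : E :=
  x i + ∑ j, a i j • (x j - x i)

/-- The sum of all squared mutual distances. -/
noncomputable def disagreement (x : ι → E) : ℝ := ∑ i, ∑ j, ‖x i - x j‖ ^ 2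

theorem disagreement_nonneg (x : ι → E) : 0 ≤ disagreement x :=
  Finset.sum_nonneg fun _ _ => Finset.sum_nonneg fun _ _ => by positivity

theorem norm_sub_sq_le_disagreement (x : ι → E) (i j : ι) : ‖x i - x j‖ ^ 2 ≤ disagreement x :=
  (Finset.single_le_sum (f := fun j => ‖x i - x j‖ ^ 2) (fun _ _ => by positivity)
    (Finset.mem_univ j)).trans
  (Finset.single_le_sum (f := fun i => ∑ j, ‖x i - x j‖ ^ 2)
    (fun _ _ => Finset.sum_nonneg fun _ _ => by positivity) (Finset.mem_univ i))

theorem disagreement_add_le (x y : ι → E) {s : ℝ} (hs : 0 < s) :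
    disagreement (x + y) ≤ (1 + s) * disagreement x + (1 + 1 / s) * disagreement y := by
  simp only [disagreement, Finset.mul_sum, ← Finset.sum_add_distrib]
  refine Finset.sum_le_sum fun i _ => Finset.sum_le_sum fun j _ => ?_
  have h : (x + y) i - (x + y) j = (x i - x j) + (y i - y j) := by simp only [Pi.add_apply]; abel
  rw [h]
  set p := ‖x i - x j‖
  set q := ‖y i - y j‖
  have h1 : ‖(x i - x j) + (y i - y j)‖ ^ 2 ≤ (p + q) ^ 2 :=
    pow_le_pow_left₀ (norm_nonneg _) (norm_add_le _ _) 2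
  have h2 : (1 + s) * p ^ 2 + (1 + 1 / s) * q ^ 2 - (p + q) ^ 2 = (s * p - q) ^ 2 / s := by
    field_simp
    ring
  have h3 : 0 ≤ (s * p - q) ^ 2 / s := by positivity
  linarith

/-- A Poincaré inequality on a connected graph. -/
theorem exists_disagreement_le {a : ι → ι → ℝ} (ha : ∀ i j, 0 ≤ a i j) {H : SimpleGraph ι}
    (hH : H.Preconnected) (hpos : ∀ i j, H.Adj i j → 0 < a i j) :
    ∃ K : ℝ, 1 ≤ K ∧ ∀ x : ι → E, disagreement x ≤ K * ∑ i, ∑ j, a i j * ‖x i - x j‖ ^ 2 := by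
  have hF : ∀ (x : ι → E) i j, a i j * ‖x i - x j‖ ^ 2
      ≤ ∑ i, ∑ j, a i j * ‖x i - x j‖ ^ 2 := fun x i j =>
    have h0 : ∀ i j, 0 ≤ a i j * ‖x i - x j‖ ^ 2 := fun i j =>
      mul_nonneg (ha i j) (by positivity)
    (Finset.single_le_sum (f := fun j => a i j * ‖x i - x j‖ ^ 2) (fun _ _ => h0 _ _)
      (Finset.mem_univ j)).trans
    (Finset.single_le_sum (f := fun i => ∑ j, a i j * ‖x i - x j‖ ^ 2)
      (fun _ _ => Finset.sum_nonneg fun _ _ => h0 _ _) (Finset.mem_univ i))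
  have hw : ∀ i j, H.Walk i j → ∃ K : ℝ, ∀ x : ι → E,
      ‖x i - x j‖ ^ 2 ≤ K * ∑ i, ∑ j, a i j * ‖x i - x j‖ ^ 2 := by
    intro i j w
    induction w with
    | nil => exact ⟨0, fun x => by simp⟩
    | @cons i k j h w ih =>
      obtain ⟨K, hK⟩ := ih
      -- From `(p + q) ^ 2 ≤ 2 p ^ 2 + 2 q ^ 2`: the first edge costs `1 / a i k`, the rest of the
      -- walk costs `K`.
      refine ⟨2 * (1 / a i k) + 2 * K, fun x => ?_⟩
      have h1 : ‖x i - x k‖ ^ 2 ≤ 1 / a i k * ∑ i, ∑ j, a i j * ‖x i - x j‖ ^ 2 := by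
        rw [one_div, ← div_eq_inv_mul, le_div_iff₀ (hpos i k h), mul_comm]
        exact hF x i k
      have h2 : ‖x i - x j‖ ^ 2 ≤ (‖x i - x k‖ + ‖x k - x j‖) ^ 2 :=
        pow_le_pow_left₀ (norm_nonneg _) (norm_sub_le_norm_sub_add_norm_sub _ _ _) 2
      nlinarith [hK x, sq_nonneg (‖x i - x k‖ - ‖x k - x j‖)]
  choose K hK using fun i j => hw i j (hH i j).some
  have hF0 : ∀ x : ι → E, 0 ≤ ∑ i, ∑ j, a i j * ‖x i - x j‖ ^ 2 := fun x =>
    Finset.sum_nonneg fun i _ => Finset.sum_nonneg fun j _ => mul_nonneg (ha i j) (by positivity)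
  refine ⟨max 1 (∑ i, ∑ j, K i j), le_max_left _ _, fun x => ?_⟩
  calc disagreement x ≤ ∑ i, ∑ j, K i j * ∑ i, ∑ j, a i j * ‖x i - x j‖ ^ 2 :=
        Finset.sum_le_sum fun i _ => Finset.sum_le_sum fun j _ => hK i j x
    _ = (∑ i, ∑ j, K i j) * ∑ i, ∑ j, a i j * ‖x i - x j‖ ^ 2 := by
        simp only [Finset.sum_mul]
    _ ≤ _ := mul_le_mul_of_nonneg_right (le_max_right _ _) (hF0 x)

variable [InnerProductSpace ℝ E]

/-- Since symmetric averaging preserves `∑ i, x i`, this turns a decrease of the sum of squares into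
a decrease of the disagreement. -/
theorem disagreement_eq (x : ι → E) :
    disagreement x = 2 * Fintype.card ι * ∑ i, ‖x i‖ ^ 2 - 2 * ‖∑ i, x i‖ ^ 2 := by
  rw [disagreement, ← real_inner_self_eq_norm_sq (∑ i, x i)]
  simp only [sum_inner, inner_sum, norm_sub_sq_real, Finset.sum_add_distrib,
    Finset.sum_sub_distrib, Finset.sum_const, Finset.card_univ, nsmul_eq_mul, ← Finset.mul_sum]
  rw [Finset.sum_comm (f := fun i j => inner ℝ (x j) (x i))]
  ring

theorem norm_sum_smul_sq_le {w : ι → ℝ} (hw : ∀ j, 0 ≤ w j) (v : ι → E) :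
    ‖∑ j, w j • v j‖ ^ 2 ≤ (∑ j, w j) * ∑ j, w j * ‖v j‖ ^ 2 := by
  have h1 : ‖∑ j, w j • v j‖ ≤ ∑ j, w j * ‖v j‖ :=
    (norm_sum_le _ _).trans_eq
      (Finset.sum_congr rfl fun j _ => by rw [norm_smul, Real.norm_of_nonneg (hw j)])
  refine (pow_le_pow_left₀ (norm_nonneg _) h1 2).trans ?_
  refine Finset.sum_sq_le_sum_mul_sum_of_sq_le_mul _ (fun j _ => hw j)
    (fun j _ => mul_nonneg (hw j) (by positivity)) fun j _ => le_of_eq ?_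
  ring

variable {a : ι → ι → ℝ}

theorem averaged_sub_const (a : ι → ι → ℝ) (x : ι → E) (z : E) (i : ι) :
    averaged a (fun i => x i - z) i = averaged a x i - z := by
  simp only [averaged, sub_sub_sub_cancel_right]
  abel

theorem sum_averaged (hsymm : ∀ i j, a i j = a j i)
    (x : ι → E) : ∑ i, averaged a x i = ∑ i, x i := by
  simp only [averaged, Finset.sum_add_distrib, smul_sub, Finset.sum_sub_distrib]
  rw [Finset.sum_comm (f := fun i j => a i j • x j)]
  rw [add_eq_left, sub_eq_zero]
  exact Finset.sum_congr rfl fun i _ => Finset.sum_congr rfl fun j _ => by rw [hsymm]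

/-- Expanding the square, the cross term yields minus the weighted squared differences. The
quadratic term costs at most half of them, by Cauchy–Schwarz and the row sum bound. The remaining
differences of squared norms cancel in the sum over `i` by symmetry. -/
theorem sum_norm_averaged_sq_le (ha : ∀ i j, 0 ≤ a i j) (hsymm : ∀ i j, a i j = a j i)
    (hrow : ∀ i, ∑ j, a i j ≤ 1 / 2)
    (x : ι → E) :
    ∑ i, ‖averaged a x i‖ ^ 2
      ≤ ∑ i, ‖x i‖ ^ 2 - 1 / 2 * ∑ i, ∑ j, a i j * ‖x i - x j‖ ^ 2 := by
  have h1 : ∀ i, ‖averaged a x i‖ ^ 2 ≤ ‖x i‖ ^ 2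
      + (∑ j, a i j * ‖x j‖ ^ 2 - ∑ j, a i j * ‖x i‖ ^ 2)
      - 1 / 2 * ∑ j, a i j * ‖x i - x j‖ ^ 2 := by
    intro i
    have h2 := norm_sum_smul_sq_le (ha i) fun j => x j - x i
    have h3 : 0 ≤ ∑ j, a i j * ‖x j - x i‖ ^ 2 :=
      Finset.sum_nonneg fun j _ => mul_nonneg (ha i j) (by positivity)
    have h4 : 2 * inner ℝ (x i) (∑ j, a i j • (x j - x i))
        = ∑ j, a i j * ‖x j‖ ^ 2 - ∑ j, a i j * ‖x i‖ ^ 2 - ∑ j, a i j * ‖x j - x i‖ ^ 2 := by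
      rw [inner_sum, Finset.mul_sum, ← Finset.sum_sub_distrib, ← Finset.sum_sub_distrib]
      refine Finset.sum_congr rfl fun j _ => ?_
      rw [norm_sub_sq_real, inner_smul_right, inner_sub_right, real_inner_self_eq_norm_sq,
        real_inner_comm]
      ring
    rw [averaged, norm_add_sq_real, h4]
    simp only [norm_sub_rev (x i)]
    nlinarith [mul_le_mul_of_nonneg_right (hrow i) h3]
  refine (Finset.sum_le_sum fun i _ => h1 i).trans_eq ?_
  have h5 : ∑ i, ∑ j, a i j * ‖x i‖ ^ 2 = ∑ i, ∑ j, a i j * ‖x j‖ ^ 2 := by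
    rw [Finset.sum_comm]
    exact Finset.sum_congr rfl fun i _ => Finset.sum_congr rfl fun j _ => by rw [hsymm]
  rw [Finset.sum_sub_distrib, Finset.sum_add_distrib, Finset.sum_sub_distrib, h5, Finset.mul_sum]
  ring

theorem sum_norm_averaged_sub_sq_le (ha : ∀ i j, 0 ≤ a i j) (hsymm : ∀ i j, a i j = a j i)
    (hrow : ∀ i, ∑ j, a i j ≤ 1 / 2)
    (x : ι → E) (z : E) :
    ∑ i, ‖averaged a x i - z‖ ^ 2 ≤ ∑ i, ‖x i - z‖ ^ 2 := by
  have h := sum_norm_averaged_sq_le ha hsymm hrow fun i => x i - z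
  simp only [averaged_sub_const] at h
  refine h.trans (sub_le_self _ (mul_nonneg (by norm_num) ?_))
  exact Finset.sum_nonneg fun i _ => Finset.sum_nonneg fun j _ =>
    mul_nonneg (ha i j) (by positivity)

theorem disagreement_averaged_le (ha : ∀ i j, 0 ≤ a i j) (hsymm : ∀ i j, a i j = a j i)
    (hrow : ∀ i, ∑ j, a i j ≤ 1 / 2)
    (x : ι → E) :
    disagreement (averaged a x)
      ≤ disagreement x - Fintype.card ι * ∑ i, ∑ j, a i j * ‖x i - x j‖ ^ 2 := by
  rw [disagreement_eq, disagreement_eq, sum_averaged hsymm]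
  have h := mul_le_mul_of_nonneg_left (sum_norm_averaged_sq_le ha hsymm hrow x)
    (by positivity : (0 : ℝ) ≤ 2 * Fintype.card ι)
  linarith

theorem averaged_mem (ha : ∀ i j, 0 ≤ a i j) (hrow : ∀ i, ∑ j, a i j ≤ 1 / 2)
    {X : Set E} (hX : Convex ℝ X) {x : ι → E} (hx : ∀ i, x i ∈ X) (i : ι) :
    averaged a x i ∈ X := by
  classical
  have h : averaged a x i = ∑ j, (a i j + if j = i then 1 - ∑ k, a i k else 0) • x j := by
    simp only [averaged, add_smul, Finset.sum_add_distrib, smul_sub, Finset.sum_sub_distrib,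
      ite_smul, zero_smul, Finset.sum_ite_eq', Finset.mem_univ, if_true, sub_smul, one_smul,
      Finset.sum_smul]
    abel
  rw [h]
  refine hX.sum_mem (fun j _ => add_nonneg (ha i j) ?_) ?_ fun j _ => hx j
  · split_ifs
    · linarith [hrow i]
    · exact le_rfl
  · simp [Finset.sum_add_distrib]

/-- Perturbed averaging over a connected graph reaches consensus when the perturbation vanishes. -/
theorem tendsto_disagreement (ha : ∀ i j, 0 ≤ a i j) (hsymm : ∀ i j, a i j = a j i)
    (hrow : ∀ i, ∑ j, a i j ≤ 1 / 2)
    [Nonempty ι] {H : SimpleGraph ι} (hH : H.Preconnected)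
    (hpos : ∀ i j, H.Adj i j → 0 < a i j) {x e : ℕ → ι → E}
    (hx : ∀ᶠ t in atTop, x (t + 1) = averaged a (x t) + e t)
    (he : ∀ i, Tendsto (fun t => e t i) atTop (𝓝 0)) :
    Tendsto (fun t => disagreement (x t)) atTop (𝓝 0) := by
  obtain ⟨K, hK1, hK⟩ := exists_disagreement_le (E := E) ha hH hpos
  have hK0 : 0 < K := by linarith
  -- Averaging contracts by `1 - 1 / K = 1 - 2 * q`. Half of this gain pays for the factor `1 + q`
  -- of `disagreement_add_le`, as `(1 + q) * (1 - 2 * q) ≤ 1 - q`.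
  set q : ℝ := 1 / (2 * K) with hq
  have hq0 : 0 < q := by positivity
  have hq1 : q ≤ 1 / 2 := by
    rw [hq, div_le_div_iff₀ (by positivity) (by norm_num)]; linarith
  have hcontr : ∀ x : ι → E, disagreement (averaged a x) ≤ (1 - 2 * q) * disagreement x := by
    intro x
    have h1 := disagreement_averaged_le ha hsymm hrow x
    have h2 : 2 * q * disagreement x ≤ ∑ i, ∑ j, a i j * ‖x i - x j‖ ^ 2 := by
      have : 2 * q = K⁻¹ := by rw [hq]; field_simp
      rw [this, inv_mul_le_iff₀ hK0]
      exact hK x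
    have h3 : (1 : ℝ) ≤ Fintype.card ι := by exact_mod_cast Fintype.card_pos
    have h4 : 0 ≤ ∑ i, ∑ j, a i j * ‖x i - x j‖ ^ 2 :=
      Finset.sum_nonneg fun i _ => Finset.sum_nonneg fun j _ =>
        mul_nonneg (ha i j) (by positivity)
    nlinarith
  refine tendsto_zero_of_le_one_sub_mul_add (a := fun _ => q)
    (ε := fun t => 1 / q * ((1 + 1 / q) * disagreement (e t)))
    (fun t => disagreement_nonneg _) (Eventually.of_forall fun _ => ⟨hq0.le, by linarith⟩) ?_ ?_ ?_
  · simp only [Finset.sum_const, Finset.card_range, nsmul_eq_mul]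
    exact tendsto_natCast_atTop_atTop.atTop_mul_const hq0
  · have h : Tendsto (fun t => disagreement (e t)) atTop (𝓝 (∑ i : ι, ∑ j : ι, ‖(0:E) - 0‖ ^ 2)) :=
      tendsto_finsetSum _ fun i _ => tendsto_finsetSum _ fun j _ =>
        (((he i).sub (he j)).norm).pow 2
    simpa using (h.const_mul (1 + 1 / q)).const_mul (1 / q)
  · filter_upwards [hx] with t ht
    rw [ht]
    have h1 := disagreement_add_le (averaged a (x t)) (e t) hq0
    have h2 := mul_le_mul_of_nonneg_left (hcontr (x t)) (by linarith : 0 ≤ 1 + q)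
    have h3 : q * (1 / q * ((1 + 1 / q) * disagreement (e t)))
        = (1 + 1 / q) * disagreement (e t) := by field_simp
    have h4 : (1 + q) * ((1 - 2 * q) * disagreement (x t)) ≤ (1 - q) * disagreement (x t) := by
      nlinarith [disagreement_nonneg (x t), mul_nonneg (sq_nonneg q) (disagreement_nonneg (x t))]
    rw [h3]
    linarith

end Averaging

/-! ### Distributed projected gradient descent with fixed weights -/

section ProjectedAveraging

variable {ι : Type*} [Fintype ι] {d : ℕ} {a : ι → ι → ℝ} {X : Set (RSpace d)}
  {f : ι → RSpace d → ℝ} {μ B : ℝ} {z : RSpace d}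

/-- One projected gradient step of all agents, started in `c`, brings them closer to the minimizer
`z`, up to an error controlled by the stepsize and by the disagreement. -/
theorem sum_norm_proj_sub_sq_le (hc : IsCompact X) (hX : Convex ℝ X) (hμ : 0 ≤ μ)
    (hf : ∀ i, StrongConvexOn Set.univ μ (f i)) (hd : ∀ i, Differentiable ℝ (f i))
    (hB : ∀ i, ∀ y ∈ X, ‖gradient (f i) y‖ ≤ B) (hz : z ∈ X)
    (hmin : ∀ y ∈ X, ∑ i, f i z ≤ ∑ i, f i y) {c : ι → RSpace d} (hcX : ∀ i, c i ∈ X) (k : ι)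
    {γ : ℝ} (hγ : 0 ≤ γ) :
    ∑ i, ‖proj X (c i - γ • gradient (f i) (c i)) - z‖ ^ 2
      ≤ (1 - γ * μ) * ∑ i, ‖c i - z‖ ^ 2
        + γ * (2 * B * ∑ i, ‖c i - c k‖ + γ * (Fintype.card ι * B ^ 2)) := by
  have h1 : ∀ i, ‖proj X (c i - γ • gradient (f i) (c i)) - z‖ ^ 2
      ≤ (1 - γ * μ) * ‖c i - z‖ ^ 2 - 2 * γ * (f i (c k) - f i z)
        + 2 * γ * B * ‖c i - c k‖ + γ ^ 2 * B ^ 2 := by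
    intro i
    set g := gradient (f i) (c i)
    have e1 : ‖proj X (c i - γ • g) - z‖ ^ 2 ≤ ‖(c i - z) - γ • g‖ ^ 2 := by
      refine pow_le_pow_left₀ (norm_nonneg _) ((norm_proj_sub_le hc hX _ hz).trans_eq ?_) 2
      congr 1
      abel
    have e2 : ‖(c i - z) - γ • g‖ ^ 2
        = ‖c i - z‖ ^ 2 - 2 * γ * inner ℝ g (c i - z) + γ ^ 2 * ‖g‖ ^ 2 := by
      rw [norm_sub_sq_real, inner_smul_right, real_inner_comm, norm_smul, mul_pow,
        Real.norm_eq_abs, sq_abs]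
      ring
    have e3 : f i (c i) - f i z + μ / 2 * ‖c i - z‖ ^ 2 ≤ inner ℝ g (c i - z) := by
      have h := (hf i).add_inner_gradient_le (hd i (c i)) z
      rw [← neg_sub (c i) z, inner_neg_right, norm_neg] at h
      linarith
    -- Moves every `f i` to the common point `c k`; only there can the sum over `i` be compared with
    -- its minimum at `z`.
    have e4 : f i (c k) - B * ‖c i - c k‖ ≤ f i (c i) := by
      have h := (hf i).add_inner_gradient_le (hd i (c k)) (c i)
      have h' := (abs_le.1 (abs_real_inner_le_norm (gradient (f i) (c k)) (c i - c k))).1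
      have h'' := mul_le_mul_of_nonneg_right (hB i _ (hcX k)) (norm_nonneg (c i - c k))
      have : 0 ≤ μ / 2 * ‖c i - c k‖ ^ 2 := by positivity
      linarith
    have e5 : ‖g‖ ^ 2 ≤ B ^ 2 := pow_le_pow_left₀ (norm_nonneg _) (hB i _ (hcX i)) 2
    have e6 : 2 * γ * (f i (c k) - B * ‖c i - c k‖ - f i z + μ / 2 * ‖c i - z‖ ^ 2)
        ≤ 2 * γ * inner ℝ g (c i - z) :=
      mul_le_mul_of_nonneg_left (by linarith) (by linarith)
    have e7 := mul_le_mul_of_nonneg_left e5 (sq_nonneg γ)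
    linarith
  refine (Finset.sum_le_sum fun i _ => h1 i).trans ?_
  simp only [Finset.sum_add_distrib, Finset.sum_sub_distrib, ← Finset.mul_sum, Finset.sum_const,
    Finset.card_univ, nsmul_eq_mul]
  have h2 := mul_nonneg hγ (sub_nonneg.2 (hmin _ (hcX k)))
  linarith

theorem exists_forall_norm_gradient_le (hc : IsCompact X)
    (hg : ∀ i, Continuous (gradient (f i))) :
    ∃ B, 0 ≤ B ∧ ∀ i, ∀ y ∈ X, ‖gradient (f i) y‖ ≤ B := by
  choose b hb using fun i => hc.exists_bound_of_continuousOn (hg i).continuousOn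
  refine ⟨∑ i, |b i|, Finset.sum_nonneg fun _ _ => abs_nonneg _, fun i y hy => ?_⟩
  exact ((hb i y hy).trans (le_abs_self _)).trans
    (Finset.single_le_sum (f := fun i => |b i|) (fun _ _ => abs_nonneg _) (Finset.mem_univ i))

/-- Convergence of the distributed projected gradient method with fixed weights. -/
theorem tendsto_of_projected_averaging [Nonempty ι] (ha : ∀ i j, 0 ≤ a i j)
    (hsymm : ∀ i j, a i j = a j i) (hrow : ∀ i, ∑ j, a i j ≤ 1 / 2) {H : SimpleGraph ι}
    (hH : H.Preconnected) (hpos : ∀ i j, H.Adj i j → 0 < a i j)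
    (hc : IsCompact X) (hX : Convex ℝ X) (hμ : 0 < μ)
    (hf : ∀ i, StrongConvexOn Set.univ μ (f i)) (hd : ∀ i, Differentiable ℝ (f i))
    (hg : ∀ i, Continuous (gradient (f i))) (hz : z ∈ X)
    (hmin : ∀ y ∈ X, ∑ i, f i z ≤ ∑ i, f i y) {γ : ℕ → ℝ} (hγ : ∀ t, 0 ≤ γ t)
    (hγ0 : Tendsto γ atTop (𝓝 0))
    (hγs : Tendsto (fun n => ∑ t ∈ Finset.range n, γ t) atTop atTop)
    {x : ℕ → ι → RSpace d} (hxX : ∀ t i, x t i ∈ X)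
    (hx : ∀ᶠ t in atTop, ∀ i, x (t + 1) i
      = proj X (averaged a (x t) i - γ t • gradient (f i) (averaged a (x t) i))) (i : ι) :
    Tendsto (fun t => x t i) atTop (𝓝 z) := by
  obtain ⟨B, hB0, hB⟩ := exists_forall_norm_gradient_le hc hg
  set c : ℕ → ι → RSpace d := fun t => averaged a (x t)
  have hcX : ∀ t i, c t i ∈ X := fun t i => averaged_mem ha hrow hX (hxX t) i
  have hdis : Tendsto (fun t => disagreement (x t)) atTop (𝓝 0) := by
    refine tendsto_disagreement ha hsymm hrow hH hpos
      -- The perturbation is the displacement by the projected step, of norm at most `γ t * B`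
      -- because `c t i` is already in `X`.
      (e := fun t i => proj X (c t i - γ t • gradient (f i) (c t i)) - c t i)
      (hx.mono fun t ht => funext fun i => ?_) fun i => ?_
    · simp only [Pi.add_apply, ht i, c]
      abel
    · refine squeeze_zero_norm (a := fun t => γ t * B) (fun t => ?_)
        (by simpa using hγ0.mul_const B)
      refine (norm_proj_sub_le hc hX _ (hcX t i)).trans ?_
      rw [sub_sub_cancel_left, norm_neg, norm_smul, Real.norm_of_nonneg (hγ t)]
      exact mul_le_mul_of_nonneg_left (hB i _ (hcX t i)) (hγ t)
  have hdisc : Tendsto (fun t => disagreement (c t)) atTop (𝓝 0) := by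
    refine squeeze_zero (fun t => disagreement_nonneg _) (fun t => ?_) hdis
    refine (disagreement_averaged_le ha hsymm hrow (x t)).trans (sub_le_self _ ?_)
    exact mul_nonneg (Nat.cast_nonneg _) (Finset.sum_nonneg fun i _ => Finset.sum_nonneg fun j _ =>
      mul_nonneg (ha i j) (by positivity))
  have hdiff : ∀ j, Tendsto (fun t => ‖c t j - c t i‖) atTop (𝓝 0) := fun j => by
    refine squeeze_zero (fun t => norm_nonneg _) (fun t => ?_)
      (by simpa using hdisc.sqrt)
    exact Real.le_sqrt_of_sq_le (norm_sub_sq_le_disagreement (c t) j i)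
  have hV : Tendsto (fun t => ∑ j, ‖x t j - z‖ ^ 2) atTop (𝓝 0) := by
    refine tendsto_zero_of_le_one_sub_mul_add (a := fun t => γ t * μ)
      -- The factor `1 / μ` compensates for the contraction rate `γ t * μ`, whereas the error
      -- carries only `γ t`.
      (ε := fun t => 1 / μ * (2 * B * ∑ j, ‖c t j - c t i‖ + γ t * (Fintype.card ι * B ^ 2)))
      (fun t => Finset.sum_nonneg fun _ _ => by positivity) ?_ ?_ ?_ ?_
    · have h : Tendsto (fun t => γ t * μ) atTop (𝓝 0) := by simpa using hγ0.mul_const μ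
      filter_upwards [h.eventually (gt_mem_nhds one_pos)] with t ht
      exact ⟨mul_nonneg (hγ t) hμ.le, ht.le⟩
    · simpa only [← Finset.sum_mul] using hγs.atTop_mul_const hμ
    · have h : Tendsto (fun t => ∑ j, ‖c t j - c t i‖) atTop (𝓝 0) := by
        simpa using tendsto_finsetSum Finset.univ fun j _ => hdiff j
      simpa using ((h.const_mul (2 * B)).add
        (hγ0.mul_const (Fintype.card ι * B ^ 2))).const_mul (1 / μ)
    · have h : Tendsto (fun t => γ t * μ) atTop (𝓝 0) := by simpa using hγ0.mul_const μ
      filter_upwards [hx, h.eventually (gt_mem_nhds one_pos)] with t ht h1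
      simp only [ht]
      refine (sum_norm_proj_sub_sq_le hc hX hμ.le hf hd hB hz hmin (hcX t) i (hγ t)).trans ?_
      refine add_le_add (mul_le_mul_of_nonneg_left
        (sum_norm_averaged_sub_sq_le ha hsymm hrow (x t) z) (by linarith)) (le_of_eq ?_)
      field_simp
  rw [tendsto_iff_norm_sub_tendsto_zero]
  refine squeeze_zero (fun t => norm_nonneg _) (fun t => ?_) (by simpa using hV.sqrt)
  exact Real.le_sqrt_of_sq_le (Finset.single_le_sum (f := fun j => ‖x t j - z‖ ^ 2)
    (fun _ _ => by positivity) (Finset.mem_univ i))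

end ProjectedAveraging

/-! ### The optimum, the trust statistics and the stepsizes -/

namespace MultiAgentSystem

variable {V Ω : Type*} {d : ℕ}

section Optimum

variable {S : MultiAgentSystem V Ω d}

theorem fL_le_fL_iff (hL : S.L.Nonempty) (x y : RSpace d) :
    S.fL x ≤ S.fL y ↔ ∑ i ∈ S.L, S.f i x ≤ ∑ i ∈ S.L, S.f i y := by
  have : (0 : ℝ) < 1 / S.L.card := by
    have : (0 : ℝ) < S.L.card := by exact_mod_cast hL.card_pos
    positivity
  exact mul_le_mul_iff_right₀ this

theorem existsUnique_isOptimal {μ : ℝ} (hL : S.L.Nonempty) (hc : IsCompact S.X)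
    (hX : Convex ℝ S.X) (hne : S.X.Nonempty) (hμ : 0 < μ)
    (hf : ∀ i ∈ S.L, StrongConvexOn Set.univ μ (S.f i))
    (hd : ∀ i ∈ S.L, Differentiable ℝ (S.f i)) : ∃! y, S.IsOptimal y := by
  have hs : StrictConvexOn ℝ S.X fun x => ∑ i ∈ S.L, S.f i x := by
    refine ⟨hX, fun x _ y _ hxy a b ha hb hab => ?_⟩
    simp only [smul_eq_mul, Finset.mul_sum, ← Finset.sum_add_distrib]
    refine Finset.sum_lt_sum_of_nonempty hL fun i hi => ?_
    exact ((hf i hi).strictConvexOn hμ).2 (Set.mem_univ _) (Set.mem_univ _) hxy ha hb hab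
  have hcont : Continuous fun x => ∑ i ∈ S.L, S.f i x :=
    continuous_finsetSum _ fun i hi => (hd i hi).continuous
  have hiff : ∀ y, IsMinOn S.fL S.X y ↔ IsMinOn (fun x => ∑ i ∈ S.L, S.f i x) S.X y := fun y => by
    simp only [isMinOn_iff, fL_le_fL_iff hL]
  obtain ⟨z, hz, hzm⟩ := hc.exists_isMinOn hne hcont.continuousOn
  exact ⟨z, ⟨hz, (hiff z).2 hzm⟩, fun y hy =>
    hs.eq_of_isMinOn ((hiff y).1 hy.2) hzm hy.1 hz⟩

end Optimum

namespace Assumptions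

variable [MeasurableSpace Ω] {P : Measure Ω} {S : MultiAgentSystem V Ω d} {EL EM μ Lip : ℝ}

theorem L_nonempty (hS : S.Assumptions P EL EM μ Lip) : S.L.Nonempty := by
  obtain ⟨i⟩ := hS.connected.nonempty
  exact ⟨i, i.2⟩

theorem X_nonempty [IsProbabilityMeasure P] (hS : S.Assumptions P EL EM μ Lip) : S.X.Nonempty := by
  obtain ⟨i, hi⟩ := hS.L_nonempty
  obtain ⟨ω⟩ := P.nonempty_of_neZero
  exact ⟨_, hS.x0_mem i hi ω⟩

theorem continuous_gradient (hS : S.Assumptions P EL EM μ Lip) {i : V} (hi : i ∈ S.L) :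
    Continuous (gradient (S.f i)) := by
  refine (LipschitzWith.of_dist_le_mul (K := Lip.toNNReal) fun y z => ?_).continuous
  rw [dist_eq_norm, dist_eq_norm]
  exact (hS.gradient_lipschitz i hi y z).trans
    (mul_le_mul_of_nonneg_right (Real.le_coe_toNNReal _) (norm_nonneg _))

/-- By the strong law of large numbers, the averaged observations converge to their mean. -/
theorem ae_tendsto_β_div [IsProbabilityMeasure P] (hS : S.Assumptions P EL EM μ Lip)
    {i j : V} (hi : i ∈ S.L)
    (hij : S.G.Adj i j) :
    ∀ᵐ ω ∂P, Tendsto (fun t : ℕ => S.β i j t ω / t) atTop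
      (𝓝 ((∫ ω, S.α i j 0 ω ∂P) - 1 / 2)) := by
  have hint : Integrable (S.α i j 0) P := by
    refine Integrable.of_bound (hS.α_measurable i hi j hij 0).aestronglyMeasurable 1
      (Eventually.of_forall fun ω => ?_)
    have h := hS.α_mem i hi j hij 0 ω
    rw [Real.norm_of_nonneg h.1]
    exact h.2
  have hm : Measurable fun y : ℝ => y - 1 / 2 := by fun_prop
  have h := strong_law_ae_real (μ := P) (fun k ω => S.α i j k ω - 1 / 2)
    (hint.sub (integrable_const _)) (fun k l hkl => ?_)
    (fun k => (hS.identDistrib i hi j hij k 0).comp hm)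
  · rw [integral_sub hint (integrable_const _), integral_const] at h
    simpa [β] using h
  -- The strong law asks only for pairwise independence along the times of one fixed edge.
  · have h1 := hS.indep.indepFun (i := (⟨(i, j), hi, hij⟩, k)) (j := (⟨(i, j), hi, hij⟩, l))
      (fun h => hkl (congrArg Prod.snd h))
    exact h1.comp hm hm

theorem measurable_β (hS : S.Assumptions P EL EM μ Lip) {i j : V} (hi : i ∈ S.L)
    (hij : S.G.Adj i j) (t : ℕ) : Measurable (S.β i j t) :=
  Finset.measurable_sum _ fun k _ => (hS.α_measurable i hi j hij k).sub_const _

theorem delayedStep_nonneg (hS : S.Assumptions P EL EM μ Lip) (T₀ t : ℕ) :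
    0 ≤ S.delayedStep T₀ t := by
  unfold delayedStep
  split_ifs
  exacts [hS.γ_nonneg _, le_rfl]

theorem tendsto_delayedStep (hS : S.Assumptions P EL EM μ Lip) (T₀ : ℕ) :
    Tendsto (S.delayedStep T₀) atTop (𝓝 0) := by
  rw [← tendsto_add_atTop_iff_nat T₀]
  have h := hS.γ_sq_sum.tendsto_atTop_zero.sqrt
  simpa [delayedStep, Real.sqrt_sq (hS.γ_nonneg _)] using h

theorem tendsto_sum_delayedStep (hS : S.Assumptions P EL EM μ Lip) (T₀ : ℕ) :
    Tendsto (fun n => ∑ t ∈ Finset.range n, S.delayedStep T₀ t) atTop atTop := by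
  rw [← tendsto_add_atTop_iff_nat T₀]
  refine hS.γ_sum.congr fun n => ?_
  rw [add_comm n, Finset.sum_range_add]
  have h : ∑ t ∈ Finset.range T₀, S.delayedStep T₀ t = 0 :=
    Finset.sum_eq_zero fun t ht => if_neg (not_le.2 (Finset.mem_range.1 ht))
  rw [h, zero_add]
  exact Finset.sum_congr rfl fun t _ => by simp [delayedStep]

end Assumptions

/-! ### The weights once trust is correct -/

variable [Fintype V]

theorem mem_nbrs (S : MultiAgentSystem V Ω d) {i j : V} : j ∈ S.nbrs i ↔ S.G.Adj i j := by
  simp [nbrs]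

open Classical in
/-- The legitimate neighbors of an agent. -/
noncomputable def legitNbrs (S : MultiAgentSystem V Ω d) (i : V) : Finset V :=
  (S.nbrs i).filter fun j => j ∈ S.L

theorem mem_legitNbrs (S : MultiAgentSystem V Ω d) {i j : V} :
    j ∈ S.legitNbrs i ↔ S.G.Adj i j ∧ j ∈ S.L := by
  simp [legitNbrs, mem_nbrs]

/-- The number of legitimate neighbors plus one. -/
noncomputable def legitDeg (S : MultiAgentSystem V Ω d) (i : V) : ℝ :=
  ((S.legitNbrs i).card : ℝ) + 1

theorem legitDeg_pos (S : MultiAgentSystem V Ω d) (i : V) : 0 < S.legitDeg i := by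
  unfold legitDeg
  positivity

open Classical in
/-- The weight of the edge between `i` and `j` when exactly the legitimate agents are trusted. -/
noncomputable def legitWeight (S : MultiAgentSystem V Ω d) (i j : V) : ℝ :=
  if S.G.Adj i j ∧ j ∈ S.L then 1 / (2 * max (S.legitDeg i) (S.legitDeg j)) else 0

section LegitWeight

variable (S : MultiAgentSystem V Ω d)

theorem max_legitDeg_pos (i j : V) : 0 < 2 * max (S.legitDeg i) (S.legitDeg j) :=
  mul_pos two_pos (lt_max_of_lt_left (S.legitDeg_pos i))

theorem legitWeight_nonneg (i j : V) : 0 ≤ S.legitWeight i j := by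
  unfold legitWeight
  split_ifs
  · exact (one_div_pos.2 (S.max_legitDeg_pos i j)).le
  · exact le_rfl

theorem legitWeight_pos {i j : V} (h : S.G.Adj i j) (hj : j ∈ S.L) : 0 < S.legitWeight i j := by
  rw [legitWeight, if_pos ⟨h, hj⟩]
  exact one_div_pos.2 (S.max_legitDeg_pos i j)

theorem legitWeight_comm {i j : V} (hi : i ∈ S.L) (hj : j ∈ S.L) :
    S.legitWeight i j = S.legitWeight j i := by
  unfold legitWeight
  by_cases h : S.G.Adj i j
  · rw [if_pos ⟨h, hj⟩, if_pos ⟨h.symm, hi⟩, max_comm]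
  · rw [if_neg fun h' => h h'.1, if_neg fun h' => h h'.1.symm]

theorem sum_legitNbrs {M : Type*} [AddCommMonoid M] (i : V) {g : V → M}
    (hg : ∀ j, S.legitWeight i j = 0 → g j = 0) :
    ∑ j ∈ S.legitNbrs i, g j = ∑ j ∈ S.L, g j := by
  refine Finset.sum_subset (fun j hj => (S.mem_legitNbrs.1 hj).2) fun j _ hj => hg j ?_
  rw [legitWeight, if_neg fun h => hj (S.mem_legitNbrs.2 h)]

theorem sum_legitWeight_le (i : V) : ∑ j ∈ S.L, S.legitWeight i j ≤ 1 / 2 := by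
  rw [← S.sum_legitNbrs i fun _ h => h]
  have hpos := S.legitDeg_pos i
  calc ∑ j ∈ S.legitNbrs i, S.legitWeight i j
      ≤ ∑ _j ∈ S.legitNbrs i, 1 / (2 * S.legitDeg i) := by
        refine Finset.sum_le_sum fun j hj => ?_
        rw [legitWeight, if_pos (S.mem_legitNbrs.1 hj)]
        exact one_div_le_one_div_of_le (by positivity)
          (mul_le_mul_of_nonneg_left (le_max_left _ _) two_pos.le)
    _ ≤ 1 / 2 := by
        rw [Finset.sum_const, nsmul_eq_mul, mul_one_div, div_le_div_iff₀ (by positivity) two_pos,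
          legitDeg]
        linarith

variable {S} {T₀ t : ℕ} {ω : Ω}

/-- Correct trust is needed at all legitimate agents, not just at `i`, because the weight also
involves the degree reported by `j`. -/
theorem weight_eq_legitWeight (ht : T₀ ≤ t) (h : ∀ i ∈ S.L, S.trusted i t ω = S.legitNbrs i)
    {i : V} (hi : i ∈ S.L) (j : V) : S.weight T₀ i j t ω = S.legitWeight i j := by
  unfold weight legitWeight
  have hmem : j ∈ S.trusted i t ω ↔ S.G.Adj i j ∧ j ∈ S.L := by rw [h i hi, S.mem_legitNbrs]
  by_cases hj : S.G.Adj i j ∧ j ∈ S.L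
  · rw [if_pos ⟨ht, hmem.2 hj⟩, if_pos hj, receivedDeg, if_pos hj.2]
    simp only [deg, h i hi, h j hj.2, legitDeg]
  · rw [if_neg fun h' => hj (hmem.1 h'.2), if_neg hj]

theorem mix_eq (ht : T₀ ≤ t) (h : ∀ i ∈ S.L, S.trusted i t ω = S.legitNbrs i)
    (x : V → Ω → RSpace d) {i : V} (hi : i ∈ S.L) :
    S.mix T₀ t x i ω = x i ω + ∑ j ∈ S.L, S.legitWeight i j • (x j ω - x i ω) := by
  classical
  have h1 : (S.legitNbrs i).filter (fun j => j ∈ S.L) = S.legitNbrs i :=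
    Finset.filter_true_of_mem fun j hj => (S.mem_legitNbrs.1 hj).2
  have h2 : (S.legitNbrs i).filter (fun j => j ∉ S.L) = ∅ :=
    Finset.filter_false_of_mem fun j hj => not_not.2 (S.mem_legitNbrs.1 hj).2
  have h3 : ∑ m ∈ S.nbrs i, S.legitWeight i m = ∑ m ∈ S.L, S.legitWeight i m := by
    rw [← S.sum_legitNbrs i fun _ h => h]
    refine (Finset.sum_subset (Finset.filter_subset _ _) fun j _ hj => ?_).symm
    rw [legitWeight, if_neg fun h => hj (S.mem_legitNbrs.2 h)]
  unfold mix selfWeight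
  rw [h i hi]
  simp only [weight_eq_legitWeight ht h hi]
  have h4 : ∑ j ∈ S.legitNbrs i, S.legitWeight i j • x j ω
      = ∑ j ∈ S.L, S.legitWeight i j • x j ω :=
    S.sum_legitNbrs i fun j hj => by rw [hj, zero_smul]
  convert_to (1 - ∑ m ∈ S.nbrs i, S.legitWeight i m) • x i ω
    + ∑ j ∈ (S.legitNbrs i).filter (fun j => j ∈ S.L), S.legitWeight i j • x j ω
    + ∑ j ∈ (S.legitNbrs i).filter (fun j => j ∉ S.L),
        S.legitWeight i j • S.advValue j i t ω = _
  rw [h1, h2, h3, h4, Finset.sum_empty, add_zero]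
  simp only [smul_sub, Finset.sum_sub_distrib, sub_smul, one_smul, Finset.sum_smul]
  abel

end LegitWeight

/-! ### Eventual correctness of trust, measurability and pathwise convergence -/

namespace Assumptions

variable [MeasurableSpace Ω] {P : Measure Ω}
  {S : MultiAgentSystem V Ω d} {EL EM μ Lip : ℝ}

/-- Almost surely, from some time on exactly the legitimate neighbors are trusted. -/
theorem ae_eventually_trusted_eq [IsProbabilityMeasure P] (hS : S.Assumptions P EL EM μ Lip) :
    ∀ᵐ ω ∂P, ∀ᶠ t in atTop, ∀ i ∈ S.L, S.trusted i t ω = S.legitNbrs i := by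
  have h : ∀ᵐ ω ∂P, ∀ i j, i ∈ S.L → S.G.Adj i j →
      Tendsto (fun t : ℕ => S.β i j t ω / t) atTop (𝓝 ((∫ ω, S.α i j 0 ω ∂P) - 1 / 2)) := by
    refine ae_all_iff.2 fun i => ae_all_iff.2 fun j => ?_
    by_cases hij : i ∈ S.L ∧ S.G.Adj i j
    · exact (hS.ae_tendsto_β_div hij.1 hij.2).mono fun ω h _ _ => h
    · exact Eventually.of_forall fun ω h1 h2 => absurd ⟨h1, h2⟩ hij
  filter_upwards [h] with ω hω
  have hev : ∀ᶠ t in atTop, ∀ i j, i ∈ S.L → S.G.Adj i j → (0 ≤ S.β i j t ω ↔ j ∈ S.L) := by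
    refine eventually_all.2 fun i => eventually_all.2 fun j => ?_
    by_cases hij : i ∈ S.L ∧ S.G.Adj i j
    · have h1 := hω i j hij.1 hij.2
      by_cases hj : j ∈ S.L
      · rw [hS.mean_legitimate i hij.1 j hj hij.2 0] at h1
        filter_upwards [h1.eventually (lt_mem_nhds hS.EL_pos), eventually_gt_atTop 0]
          with t ht ht0 _ _
        have : (0 : ℝ) < t := by exact_mod_cast ht0
        exact iff_of_true ((div_pos_iff_of_pos_right this).1 ht).le hj
      · rw [hS.mean_malicious i hij.1 j hj hij.2 0] at h1
        filter_upwards [h1.eventually (gt_mem_nhds hS.EM_neg), eventually_gt_atTop 0]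
          with t ht ht0 _ _
        refine iff_of_false (fun h0 => ?_) hj
        exact absurd (div_nonneg h0 (Nat.cast_nonneg t)) (not_le.2 ht)
    · exact Eventually.of_forall fun ω h1 h2 => absurd ⟨h1, h2⟩ hij
  filter_upwards [hev] with t ht i hi
  ext j
  simp only [trusted, legitNbrs, Finset.mem_filter, mem_nbrs]
  exact and_congr_right fun hij => ht i j hi hij

theorem measurableSet_mem_trusted (hS : S.Assumptions P EL EM μ Lip) {i : V} (hi : i ∈ S.L)
    (j : V) (t : ℕ) : MeasurableSet {ω | j ∈ S.trusted i t ω} := by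
  simp only [trusted, Finset.mem_filter, mem_nbrs]
  by_cases hij : S.G.Adj i j
  · simpa only [hij, true_and] using
      measurableSet_le measurable_const (hS.measurable_β hi hij t)
  · simp [hij]

theorem measurable_deg (hS : S.Assumptions P EL EM μ Lip) {i : V} (hi : i ∈ S.L) (t : ℕ) :
    Measurable (S.deg i t) := by
  classical
  have h : S.deg i t = fun ω => (∑ j, if j ∈ S.trusted i t ω then (1 : ℝ) else 0) + 1 := by
    funext ω
    simp [deg]
  rw [h]
  exact (Finset.measurable_sum _ fun j _ => Measurable.ite
    (hS.measurableSet_mem_trusted hi j t) measurable_const measurable_const).add_const 1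

theorem measurable_weight (hS : S.Assumptions P EL EM μ Lip) (T₀ : ℕ) {i : V} (hi : i ∈ S.L)
    (j : V) (t : ℕ) : Measurable (S.weight T₀ i j t) := by
  by_cases hij : S.G.Adj i j
  · have hr : Measurable (S.receivedDeg i j t) := by
      unfold receivedDeg
      by_cases hj : j ∈ S.L
      · simpa only [if_pos hj] using hS.measurable_deg hj t
      · simpa only [if_neg hj] using hS.advDegree_measurable i hi j hj hij t
    unfold weight
    refine Measurable.ite ?_ ?_ measurable_const
    · exact (MeasurableSet.const _).inter (hS.measurableSet_mem_trusted hi j t)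
    · exact measurable_const.div (measurable_const.mul ((hS.measurable_deg hi t).max hr))
  · have h : S.weight T₀ i j t = fun _ => 0 := by
      funext ω
      rw [weight, if_neg]
      simp [trusted, mem_nbrs, hij]
    rw [h]
    exact measurable_const

theorem measurable_mix (hS : S.Assumptions P EL EM μ Lip) (T₀ t : ℕ) {x : V → Ω → RSpace d}
    (hx : ∀ i ∈ S.L, Measurable (x i)) {i : V} (hi : i ∈ S.L) :
    Measurable (S.mix T₀ t x i) := by
  classical
  -- The index set is random; indicators turn the sum into one over a fixed set, measurable term by
  -- term.
  have hsum : ∀ (ω : Ω) (p : V → Prop) (F : V → RSpace d),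
      ∑ j ∈ (S.trusted i t ω).filter p, F j
        = ∑ j, if j ∈ S.trusted i t ω then (if p j then F j else 0) else 0 := fun ω p F => by
    rw [Finset.sum_filter, ← Finset.sum_filter (fun j => j ∈ S.trusted i t ω),
      Finset.filter_univ_mem]
  have hw := fun j => hS.measurable_weight T₀ hi j t
  have hms : ∀ (p : V → Prop) (F : V → Ω → RSpace d),
      (∀ j, p j → S.G.Adj i j → Measurable (F j)) →
      Measurable fun ω => ∑ j ∈ (S.trusted i t ω).filter p, F j ω := fun p F hF => by
    simp only [hsum]
    refine Finset.measurable_sum _ fun j _ => ?_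
    by_cases hj : p j ∧ S.G.Adj i j
    · simp only [hj.1, if_true]
      exact Measurable.ite (hS.measurableSet_mem_trusted hi j t) (hF j hj.1 hj.2) measurable_const
    · convert (measurable_const : Measurable fun _ : Ω => (0 : RSpace d)) using 2 with ω
      rw [ite_eq_right_iff, ite_eq_right_iff]
      intro h1 h2
      exact absurd ⟨h2, S.mem_nbrs.1 (Finset.mem_filter.1 h1).1⟩ hj
  unfold mix selfWeight
  refine ((Measurable.smul (measurable_const.sub (Finset.measurable_sum _ fun j _ => hw j))
    (hx i hi)).add ?_).add ?_
  · convert hms (fun j => j ∈ S.L) (fun j ω => S.weight T₀ i j t ω • x j ω)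
      (fun j hj _ => (hw j).smul (hx j hj)) using 3
    ext; simp
  · convert hms (fun j => j ∉ S.L) (fun j ω => S.weight T₀ i j t ω • S.advValue j i t ω)
      (fun j hj hij => (hw j).smul (hS.advValue_measurable i hi j hj hij t)) using 3
    ext; simp

theorem measurable_x [IsProbabilityMeasure P] (hS : S.Assumptions P EL EM μ Lip) (T₀ t : ℕ) :
    ∀ i ∈ S.L, Measurable (S.x T₀ t i) := by
  induction t with
  | zero => exact hS.x0_measurable
  | succ t ih =>
    intro i hi
    have hm := hS.measurable_mix T₀ t ih hi
    have hg := hS.continuous_gradient hi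
    have hstep : Continuous fun y => proj S.X (y - S.delayedStep T₀ t • gradient (S.f i) y) :=
      (continuous_proj hS.X_compact hS.X_convex hS.X_nonempty).comp (by fun_prop)
    exact hstep.measurable.comp hm

theorem x_mem [IsProbabilityMeasure P] (hS : S.Assumptions P EL EM μ Lip)
    (T₀ t : ℕ) {i : V} (hi : i ∈ S.L) (ω : Ω) :
    S.x T₀ t i ω ∈ S.X := by
  cases t with
  | zero => exact hS.x0_mem i hi ω
  | succ t => exact proj_mem hS.X_compact hS.X_nonempty _

/-- On a fixed sample path with eventually correct trust, the recursion is eventually the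
deterministic one on the subtype of legitimate agents, and that theorem requires the recursion only
eventually. -/
theorem tendsto_x [IsProbabilityMeasure P] (hS : S.Assumptions P EL EM μ Lip)
    {z : RSpace d} (hz : S.IsOptimal z) (T₀ : ℕ)
    {ω : Ω} (hω : ∀ᶠ t in atTop, ∀ i ∈ S.L, S.trusted i t ω = S.legitNbrs i)
    {i : V} (hi : i ∈ S.L) : Tendsto (fun t => S.x T₀ t i ω) atTop (𝓝 z) := by
  have hsum : ∀ {M : Type} [AddCommMonoid M] (g : V → M),
      ∑ j : (S.L : Set V), g j = ∑ j ∈ S.L, g j := fun g =>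
    (Finset.sum_subtype S.L (fun _ => Finset.mem_coe.symm) g).symm
  have : Nonempty (S.L : Set V) := ⟨⟨i, hi⟩⟩
  refine tendsto_of_projected_averaging (ι := (S.L : Set V))
    (a := fun j k => S.legitWeight j k) (X := S.X) (f := fun j => S.f j) (μ := μ)
    (γ := S.delayedStep T₀) (x := fun t j => S.x T₀ t j ω)
    (fun j k => S.legitWeight_nonneg j k) (fun j k => S.legitWeight_comm j.2 k.2)
    (fun j => (hsum fun k => S.legitWeight j k).trans_le (S.sum_legitWeight_le j))
    hS.connected.preconnected (fun j k h => S.legitWeight_pos h k.2)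
    hS.X_compact hS.X_convex hS.μ_pos (fun j => hS.strongConvex j j.2)
    (fun j => hS.differentiable j j.2) (fun j => hS.continuous_gradient j.2) hz.1
    (fun y hy => ?_) (hS.delayedStep_nonneg T₀) (hS.tendsto_delayedStep T₀)
    (hS.tendsto_sum_delayedStep T₀) (fun t j => hS.x_mem T₀ t j.2 ω) ?_ ⟨i, hi⟩
  · rw [hsum fun j => S.f j z, hsum fun j => S.f j y]
    exact (fL_le_fL_iff hS.L_nonempty z y).1 (isMinOn_iff.1 hz.2 y hy)
  · filter_upwards [hω, eventually_ge_atTop T₀] with t ht hT j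
    have h : averaged (fun j k : (S.L : Set V) => S.legitWeight j k)
        (fun j => S.x T₀ t j ω) j = S.mix T₀ t (S.x T₀ t) j ω := by
      rw [mix_eq hT ht _ j.2, averaged,
        hsum fun k => S.legitWeight j k • (S.x T₀ t k ω - S.x T₀ t j ω)]
    rw [h]
    rfl

end Assumptions

end MultiAgentSystem

/-! ### From pathwise convergence to convergence of moments -/

theorem mainTheorem2 {V Ω : Type*} [Fintype V] {d : ℕ} [MeasurableSpace Ω]
    (P : Measure Ω) [IsProbabilityMeasure P] (S : MultiAgentSystem V Ω d)
    (EL EM μ Lip : ℝ) (hS : S.Assumptions P EL EM μ Lip) :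
    (∃! y : RSpace d, S.IsOptimal y) ∧
    ∀ xStar : RSpace d, S.IsOptimal xStar →
      ∀ T₀ : ℕ, ∀ i ∈ S.L, ∀ r : ℝ, 1 ≤ r →
        (∀ t, Integrable (fun ω => ‖S.x T₀ t i ω - xStar‖ ^ r) P) ∧
        Tendsto (fun t => ∫ ω, ‖S.x T₀ t i ω - xStar‖ ^ r ∂P) atTop (𝓝 0) := by
  refine ⟨S.existsUnique_isOptimal hS.L_nonempty hS.X_compact hS.X_convex hS.X_nonempty hS.μ_pos
    hS.strongConvex hS.differentiable, fun z hz T₀ i hi r hr => ?_⟩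
  have hr0 : 0 < r := by linarith
  -- `C` bounds the distances within `X`, so `C ^ r` dominates uniformly in time and over the sample
  -- space.
  obtain ⟨C, hC⟩ := Metric.isBounded_iff.1 hS.X_compact.isBounded
  have hmeas : ∀ t, AEStronglyMeasurable (fun ω => ‖S.x T₀ t i ω - z‖ ^ r) P := fun t =>
    (((hS.measurable_x T₀ t i hi).sub_const z).norm.pow_const r).aestronglyMeasurable
  have hbound : ∀ t, ∀ᵐ ω ∂P, ‖‖S.x T₀ t i ω - z‖ ^ r‖ ≤ C ^ r := fun t =>
    Eventually.of_forall fun ω => by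
      rw [Real.norm_of_nonneg (by positivity), ← dist_eq_norm]
      exact Real.rpow_le_rpow dist_nonneg (hC (hS.x_mem T₀ t hi ω) hz.1) hr0.le
  refine ⟨fun t => Integrable.of_bound (hmeas t) _ (hbound t), ?_⟩
  have h := tendsto_integral_of_dominated_convergence (f := fun _ => (0 : ℝ)) (fun _ => C ^ r)
    hmeas (integrable_const _) hbound ?_
  · simpa using h
  · filter_upwards [hS.ae_eventually_trusted_eq] with ω hω
    have h1 := (tendsto_iff_norm_sub_tendsto_zero.1 (hS.tendsto_x hz T₀ hω hi)).rpow_const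
      (Or.inr hr0.le)
    rwa [Real.zero_rpow hr0.ne'] at h1
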